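/- Let $G$ be a compact Lie group acting smoothly on a connected non-compact smooth manifold $M$ with an orbit of codimension one. Suppose that $M$ has exactly one singular orbit and group diagram $G\supset H\supset K$. This means that, for some $G$-invariant Riemannian metric on $M$, the orbit space $M/G$ is identified with an interval $[0,L)$, $0<L\le\infty$, and there is a unit speed geodesic $\gamma\colon[0,L)\to M$, orthogonal to the orbits through $\gamma(t)$ for $0<t<L$, such that $\gamma(t)$ lies in the orbit corresponding to $t$ for every $t\in[0,L)$, $H$ is the isotropy group of $\gamma(0)$, and $K\subset H$ is the isotropy group of $\gamma(t)$ for all $0<t<L$. Suppose that $H/K$ is homeomorphic to a sphere $S^l$ with $l\ge 1$. Consider the homomorphisms $\pi_1(H/K)\to\pi_1(G/K)$ and $\pi_1(G/K)\to\pi_1(G/H)$ induced by the inclusion $H/K\to G/K$ and the projection $G/K\to G/H$, all fundamental groups being based at the coset of the identity. Then $$N:=\ker\{\pi_1(G/K)\to\pi_1(G/H)\}=\operatorname{Im}\{\pi_1(H/K)\to\pi_1(G/K)\}$$ and $$\pi_1(M)\cong\pi_1(G/K)/N .$$ In particular, $M$ is simply connected if and only if the image of $\pi_1(S^l)$, under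 $S^l\cong H/K\to G/K$, generates $\pi_1(G/K)$. -/

import Mathlib

open scoped Manifold ContDiff Topology Bundle

noncomputable section

namespace CohomOne

section Action

variable {EG : Type*} [NormedAddCommGroup EG] [NormedSpace ℝ EG]
  {E : Type*} [NormedAddCommGroup E] [NormedSpace ℝ E]
  (G : Type*) [Group G] [TopologicalSpace G] [ChartedSpace EG G]
  {M : Type*} [TopologicalSpace M] [ChartedSpace E M] [MulAction G M]

variable (EG) in
/-- The tangent space at `p` of the orbit `G • p`: the image of the differential at `1` of the
orbit map `a ↦ a • p`. -/
def orbitTangentSpace (p : M) : Submodule ℝ (TangentSpace 𝓘(ℝ, E) p) :=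
  LinearMap.range
    (mfderiv 𝓘(ℝ, EG) 𝓘(ℝ, E) (fun a : G => a • p) 1 : EG →L[ℝ] E).toLinearMap

variable (EG E M) in
/-- `M` is a cohomogeneity one `G`-manifold: it is connected and some orbit has codimension one.
(That `G` is a compact Lie group acting smoothly on the manifold `M` is expressed by
type classes.) -/
structure IsCohomogeneityOne : Prop where
  connected : ConnectedSpace M
  exists_codim_one : ∃ p : M,
    Module.finrank ℝ (orbitTangentSpace EG G (E := E) p) + 1 = Module.finrank ℝ E

end Action

section Metric

variable {E : Type*} [NormedAddCommGroup E] [NormedSpace ℝ E]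
  {M : Type*} [TopologicalSpace M] [ChartedSpace E M] [IsManifold 𝓘(ℝ, E) ∞ M]

variable (E M) in
/-- Smooth Riemannian metrics on `M`. -/
abbrev RiemMetric :=
  Bundle.ContMDiffRiemannianMetric 𝓘(ℝ, E) ∞ E (fun x : M => TangentSpace 𝓘(ℝ, E) x)

/-- The Riemannian distance of the metric `g`: the infimum of the `g`-lengths of `C¹` paths. -/
def RiemMetric.edist (g : RiemMetric E M) (x y : M) : ENNReal :=
  letI : Bundle.RiemannianBundle (fun x : M => TangentSpace 𝓘(ℝ, E) x) :=
    ⟨g.toRiemannianMetric⟩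
  Manifold.riemannianEDist 𝓘(ℝ, E) x y

/-- `g` is `G`-invariant: every element of `G` acts by isometries. -/
def RiemMetric.IsInvariant (G : Type*) [Group G] [MulAction G M] (g : RiemMetric E M) : Prop :=
  ∀ (a : G) (p : M) (v w : TangentSpace 𝓘(ℝ, E) p),
    g.inner (a • p) (mfderiv 𝓘(ℝ, E) 𝓘(ℝ, E) (fun q : M => a • q) p v)
      (mfderiv 𝓘(ℝ, E) 𝓘(ℝ, E) (fun q : M => a • q) p w) = g.inner p v w

/-- The interval `[0, L)`, where `L` may be `+∞`. -/
def halfOpen (L : EReal) : Set ℝ := {t : ℝ | 0 ≤ t ∧ (t : EReal) < L}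

/-- `γ` restricted to `[0, L)` is a unit speed geodesic of `g`: a smooth curve that locally
realises the distance and is parametrised by arc length. -/
structure IsUnitSpeedGeodesic (g : RiemMetric E M) (L : EReal) (γ : ℝ → M) : Prop where
  smooth : ContMDiffOn 𝓘(ℝ, ℝ) 𝓘(ℝ, E) ∞ γ (halfOpen L)
  locally_minimizing : ∀ t₀ ∈ halfOpen L, ∃ ε > 0, ∀ s ∈ halfOpen L, ∀ t ∈ halfOpen L,
    |s - t₀| < ε → |t - t₀| < ε → g.edist (γ s) (γ t) = ENNReal.ofReal |s - t|

/-- `γ` is a normal geodesic on `[0, L)`: a unit speed geodesic orthogonal to the orbits through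
the points `γ t`, `0 < t < L` (the principal orbits). -/
structure IsNormalGeodesic (EG : Type*) [NormedAddCommGroup EG] [NormedSpace ℝ EG]
    (G : Type*) [Group G] [TopologicalSpace G] [ChartedSpace EG G] [MulAction G M]
    (g : RiemMetric E M) (L : EReal) (γ : ℝ → M) : Prop where
  geodesic : IsUnitSpeedGeodesic g L γ
  orthogonal : ∀ t ∈ halfOpen L, 0 < t → ∀ v ∈ orbitTangentSpace EG G (E := E) (γ t),
    g.inner (γ t) (mfderivWithin 𝓘(ℝ, ℝ) 𝓘(ℝ, E) γ (halfOpen L) t (1 : ℝ)) v = 0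

variable (E M) in
/-- `G ⊃ H ⊃ K` is the group diagram of the non-compact cohomogeneity one manifold `M` with one
singular orbit: there are a `G`-invariant metric on `M`, an identification of the orbit space
`M / G` with `[0, L)`, `0 < L ≤ ∞`, and a normal geodesic `γ : [0, L) → M` which is a section of
`M → M / G = [0, L)`, such that `H` is the isotropy group of `γ 0` and `K` is the isotropy group
of `γ t` for all `0 < t < L`. -/
def IsGroupDiagram (EG : Type*) [NormedAddCommGroup EG] [NormedSpace ℝ EG]
    {G : Type*} [Group G] [TopologicalSpace G] [ChartedSpace EG G] [MulAction G M]
    (H K : Subgroup G) : Prop :=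
  ∃ (g : RiemMetric E M) (L : EReal) (γ : ℝ → M)
    (φ : MulAction.orbitRel.Quotient G M ≃ₜ halfOpen L),
    g.IsInvariant G ∧ 0 < L ∧ IsNormalGeodesic EG G g L γ ∧
    (∀ t ∈ halfOpen L, (φ (Quotient.mk _ (γ t)) : ℝ) = t) ∧
    MulAction.stabilizer G (γ 0) = H ∧
    ∀ t ∈ halfOpen L, 0 < t → MulAction.stabilizer G (γ t) = K

end Metric

section Homogeneous

variable {G : Type*} [Group G] [TopologicalSpace G] {H K : Subgroup G}

/-- The projection `G / K → G / H`, `aK ↦ aH`, for `K ≤ H`. -/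
def proj (h : K ≤ H) : C(G ⧸ K, G ⧸ H) where
  toFun := Subgroup.quotientMapOfLE h
  continuous_toFun := by
    refine continuous_quot_lift _ ?_
    exact continuous_quotient_mk'

variable (H K) in
/-- The inclusion `H / K → G / K`, `aK ↦ aK`. -/
def incl : C(H ⧸ K.subgroupOf H, G ⧸ K) where
  toFun := Quotient.map' (fun a : H => (a : G)) (fun a b hab => by
    rw [QuotientGroup.leftRel_apply] at hab ⊢
    exact hab)
  continuous_toFun := by
    refine Continuous.quotient_map' continuous_subtype_val _

/-- `π₁(G / K) → π₁(G / H)`, based at the cosets of `1`. -/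
def projHom (h : K ≤ H) :
    FundamentalGroup (G ⧸ K) ((1 : G) : G ⧸ K) →*
      FundamentalGroup (G ⧸ H) ((1 : G) : G ⧸ H) :=
  FundamentalGroup.mapOfEq (proj h) rfl

variable (H K) in
/-- `π₁(H / K) → π₁(G / K)`, based at the cosets of `1`. -/
def inclHom :
    FundamentalGroup (H ⧸ K.subgroupOf H) ((1 : H) : H ⧸ K.subgroupOf H) →*
      FundamentalGroup (G ⧸ K) ((1 : G) : G ⧸ K) :=
  FundamentalGroup.mapOfEq (incl H K) rfl

/-- The homomorphism `π₁(S) → π₁(G / K)` induced by an identification `e` of a space `S` (to be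
applied to a sphere) with `H / K`, followed by the inclusion `H / K → G / K`. -/
def sphereHom {S : Type*} [TopologicalSpace S] (e : S ≃ₜ H ⧸ K.subgroupOf H) :
    FundamentalGroup S (e.symm ((1 : H) : H ⧸ K.subgroupOf H)) →*
      FundamentalGroup (G ⧸ K) ((1 : G) : G ⧸ K) :=
  FundamentalGroup.mapOfEq ((incl H K).comp (e : C(S, H ⧸ K.subgroupOf H)))
    (congrArg (incl H K) (e.apply_symm_apply _))

end Homogeneous

end CohomOne

end

/-!
The geometry enters only through the section `γ : [0, L) → M` of the orbit map. Every point of `M`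
is `g • γ t` with `t` unique, and the isotropy group is `K` for `t > 0` and the larger group `H` for
`t = 0`. Hence `g • γ t ↦ g • γ ((1 - s) * t)` is a well defined deformation of `M` onto the orbit
`G ⧸ H` of `γ 0`; it is continuous because `G` is compact (`exists_homotopyEquiv_quotient`). So the
fundamental group of `M` is that of `G ⧸ H`.

It remains to see that `π₁(H / K) → π₁(G / K) → π₁(G / H) → 1` is exact, where `H / K` is path
connected as a sphere of positive dimension. This follows from the lifting of paths and homotopies
through `G → G ⧸ H` (`exists_lift_square`): multiplying a point of `G ⧸ K` by a lifted homotopy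
lifts homotopies to `G ⧸ K` (`exists_path_proj_homotopic`, `exists_path_incl_homotopic`).

Lifting needs continuous local sections of `G → G ⧸ H`. Since `H` is the isotropy group of a smooth
action, they come from the orbit map `g ↦ g • γ 0`: by equivariance it has constant rank, and the
constant rank theorem (`ContDiffAt.exists_section_of_finrank_le`) factors it locally through a
continuous section (`exists_local_section_quotient_stabilizer`).
-/

/-! ### Constant rank -/

theorem LinearMap.ker_comp_eq_ker_of_surjective_of_finrank_le {V E F : Type*}
    [AddCommGroup V] [Module ℝ V] [AddCommGroup E] [Module ℝ E] [AddCommGroup F] [Module ℝ F]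
    [FiniteDimensional ℝ V] [FiniteDimensional ℝ F]
    (A : V →ₗ[ℝ] E) (q : E →ₗ[ℝ] F) (hq : Function.Surjective (q ∘ₗ A))
    (hr : Module.finrank ℝ (LinearMap.range A) ≤ Module.finrank ℝ F) :
    LinearMap.ker (q ∘ₗ A) = LinearMap.ker A := by
  refine (Submodule.eq_of_le_of_finrank_le (LinearMap.ker_le_ker_comp A q) ?_).symm
  have h1 := LinearMap.finrank_range_add_finrank_ker A
  have h2 := LinearMap.finrank_range_add_finrank_ker (q ∘ₗ A)
  rw [LinearMap.range_eq_top.2 hq, finrank_top] at h2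
  omega

/-- A form of the constant rank theorem: if the rank of the derivative near `x₀` is at most that
at `x₀`, then near `x₀` the map `f` factors as `f = f ∘ s ∘ f` with `s` continuous. If `q`
projects onto the range of `fderiv ℝ f x₀`, then `q ∘ f` is a submersion, and `f` is constant
along its fibres because there the kernels of the derivatives of `f` and `q ∘ f` agree. So `f x`
is determined by `q (f x)`, and `s = ρ ∘ q` for a local right inverse `ρ` of `q ∘ f`. -/
theorem ContDiffAt.exists_section_of_finrank_le
    {V E : Type*} [NormedAddCommGroup V] [NormedSpace ℝ V] [FiniteDimensional ℝ V]
    [NormedAddCommGroup E] [NormedSpace ℝ E] [FiniteDimensional ℝ E]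
    {f : V → E} {x₀ : V} (hf : ContDiffAt ℝ 1 f x₀)
    (hr : ∀ᶠ x in 𝓝 x₀, Module.finrank ℝ (LinearMap.range (fderiv ℝ f x).toLinearMap) ≤
      Module.finrank ℝ (LinearMap.range (fderiv ℝ f x₀).toLinearMap)) :
    ∃ s : E → V, s (f x₀) = x₀ ∧ (∀ᶠ y in 𝓝 (f x₀), ContinuousAt s y) ∧
      ∀ᶠ x in 𝓝 x₀, f (s (f x)) = f x := by
  have : CompleteSpace V := FiniteDimensional.complete ℝ V
  set R := LinearMap.range (fderiv ℝ f x₀).toLinearMap with hR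
  have : CompleteSpace R := FiniteDimensional.complete ℝ R
  obtain ⟨q, hq⟩ : R.ClosedComplemented := Submodule.ClosedComplemented.of_finiteDimensional R
  have hqf : ContDiffAt ℝ 1 (fun x => q (f x)) x₀ := q.contDiff.contDiffAt.comp x₀ hf
  set q' : V →L[ℝ] R := q ∘L fderiv ℝ f x₀ with hq'
  have hstrict : HasStrictFDerivAt (fun x => q (f x)) q' x₀ :=
    q.hasStrictFDerivAt.comp x₀ (hf.hasStrictFDerivAt one_ne_zero)
  have hsurj : q'.range = ⊤ := by
    refine LinearMap.range_eq_top.2 fun v => ?_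
    obtain ⟨w, hw⟩ := v.2
    exact ⟨w, (congrArg q hw).trans (hq v)⟩
  have hker : q'.ker.ClosedComplemented := Submodule.ClosedComplemented.of_finiteDimensional _
  -- the chart `Ψ x = (q (f x), p (x - x₀))`, where `p` is a projection onto `ker (q ∘ f' x₀)`
  set Ψ := hstrict.implicitToOpenPartialHomeomorphOfComplemented _ _ hsurj hker with hΨ
  have hΨfst (x : V) : (Ψ x).1 = q (f x) := rfl
  have hΨ₀ : Ψ x₀ = (q (f x₀), 0) :=
    hstrict.implicitToOpenPartialHomeomorphOfComplemented_self hsurj hker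
  have hx₀ : x₀ ∈ Ψ.source :=
    hstrict.mem_implicitToOpenPartialHomeomorphOfComplemented_source hsurj hker
  have hz₀ : Ψ x₀ ∈ Ψ.target := Ψ.map_source hx₀
  have hleft : Ψ.symm (Ψ x₀) = x₀ := Ψ.left_inv hx₀
  have hsymm : ContDiffAt ℝ 1 Ψ.symm (Ψ x₀) := by
    refine Ψ.contDiffAt_symm hz₀ (f₀' := q'.equivProdOfSurjectiveOfIsCompl (Classical.choose hker)
      hsurj (LinearMap.range_eq_of_proj (Classical.choose_spec hker))
      (LinearMap.isCompl_of_proj (Classical.choose_spec hker))) ?_ ?_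
    · rw [hleft]
      exact (ImplicitFunctionData.hasStrictFDerivAt
        (HasStrictFDerivAt.implicitFunctionDataOfComplemented _ _ hstrict hsurj hker)).hasFDerivAt
    · rw [hleft]
      exact hqf.prodMk ((Classical.choose hker).contDiff.contDiffAt.comp x₀
        (contDiffAt_id.sub contDiffAt_const))
  have htend : Filter.Tendsto Ψ.symm (𝓝 (Ψ x₀)) (𝓝 x₀) := by
    simpa only [hleft] using hsymm.continuousAt.tendsto
  have hev : ∀ᶠ z in 𝓝 (Ψ x₀), z ∈ Ψ.target ∧ DifferentiableAt ℝ Ψ.symm z ∧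
      DifferentiableAt ℝ f (Ψ.symm z) ∧
      Module.finrank ℝ (LinearMap.range (fderiv ℝ f (Ψ.symm z)).toLinearMap) ≤
        Module.finrank ℝ R := by
    filter_upwards [Ψ.open_target.mem_nhds hz₀, hsymm.eventually (by simp),
      htend.eventually (hf.eventually (by simp)), htend.eventually hr] with z h1 h2 h3 h4
    exact ⟨h1, h2.differentiableAt one_ne_zero, h3.differentiableAt one_ne_zero, h4⟩
  obtain ⟨ε, hε, hball⟩ := Metric.eventually_nhds_iff_ball.1 hev
  -- in this chart the partial derivative of `f` along the kernel vanishes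
  have hder (a : R) (b : q'.ker) (hab : (a, b) ∈ Metric.ball (Ψ x₀) ε) :
      HasFDerivAt (fun b' => f (Ψ.symm (a, b'))) (0 : q'.ker →L[ℝ] E) b := by
    obtain ⟨h1, h2, h3, h4⟩ := hball _ hab
    have hcomp : HasFDerivAt (f ∘ Ψ.symm)
        ((fderiv ℝ f (Ψ.symm (a, b))) ∘L fderiv ℝ Ψ.symm (a, b)) (a, b) :=
      h3.hasFDerivAt.comp _ h2.hasFDerivAt
    have hfst : q ∘L (fderiv ℝ f (Ψ.symm (a, b)) ∘L fderiv ℝ Ψ.symm (a, b)) =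
        ContinuousLinearMap.fst ℝ R q'.ker := by
      refine (q.hasFDerivAt.comp _ hcomp).unique (hasFDerivAt_fst.congr_of_eventuallyEq ?_)
      filter_upwards [Ψ.open_target.mem_nhds h1] with z hz
      simp only [Function.comp_apply, ← hΨfst, Ψ.right_inv hz]
    have hk := LinearMap.ker_comp_eq_ker_of_surjective_of_finrank_le
      (fderiv ℝ f (Ψ.symm (a, b))).toLinearMap q.toLinearMap
      (fun v => ⟨fderiv ℝ Ψ.symm (a, b) (v, 0), DFunLike.congr_fun hfst (v, 0)⟩) h4
    have hpart := hcomp.comp b (hasFDerivAt_prodMk_right a b)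
    refine hpart.congr_fderiv (ContinuousLinearMap.ext fun v => ?_)
    have hv : fderiv ℝ Ψ.symm (a, b) (0, v) ∈
        LinearMap.ker (q.toLinearMap ∘ₗ (fderiv ℝ f (Ψ.symm (a, b))).toLinearMap) :=
      DFunLike.congr_fun hfst (0, v)
    exact (LinearMap.mem_ker.1 (hk.le hv))
  refine ⟨fun y => Ψ.symm (q y, 0), by simpa only [hΨ₀] using hleft, ?_, ?_⟩
  · have : Filter.Tendsto (fun y => (q y, (0 : q'.ker))) (𝓝 (f x₀)) (𝓝 (Ψ x₀)) := by
      rw [hΨ₀]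
      exact (q.continuous.prodMk continuous_const).tendsto _
    filter_upwards [this.eventually hev] with y hy
    exact ContinuousAt.comp (f := fun y => (q y, (0 : q'.ker))) hy.2.1.continuousAt
      (q.continuous.prodMk continuous_const).continuousAt
  · filter_upwards [Ψ.open_source.mem_nhds hx₀,
      (Ψ.continuousAt hx₀).eventually (Metric.ball_mem_nhds _ hε)] with x hx hxb
    have hmem (b : q'.ker) (hb : b ∈ Metric.ball (0 : q'.ker) ε) :
        (q (f x), b) ∈ Metric.ball (Ψ x₀) ε := by
      rw [Prod.dist_eq, max_lt_iff, hΨ₀] at hxb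
      rw [Metric.mem_ball, Prod.dist_eq, max_lt_iff, hΨ₀]
      exact ⟨hxb.1, hb⟩
    have hb : (Ψ x).2 ∈ Metric.ball (0 : q'.ker) ε := by
      rw [Prod.dist_eq, max_lt_iff, hΨ₀] at hxb
      exact hxb.2
    have hconst := Metric.isOpen_ball.is_const_of_fderiv_eq_zero (𝕜 := ℝ)
      (convex_ball (0 : q'.ker) ε).isPreconnected
      (fun b hb => (hder _ b (hmem b hb)).differentiableAt.differentiableWithinAt)
      (fun b hb => (hder _ b (hmem b hb)).fderiv) (Metric.mem_ball_self hε) hb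
    have hx' : Ψ.symm (q (f x), (Ψ x).2) = x := by
      rw [← hΨfst]
      exact Ψ.left_inv hx
    simpa only [hx'] using hconst

/-! ### Local sections over an orbit -/

theorem ContMDiffAt.contDiffAt_extChartAt_comp {E E' N N' : Type*}
    [NormedAddCommGroup E] [NormedSpace ℝ E] [NormedAddCommGroup E'] [NormedSpace ℝ E']
    [TopologicalSpace N] [ChartedSpace E N] [IsManifold 𝓘(ℝ, E) ∞ N]
    [TopologicalSpace N'] [ChartedSpace E' N'] [IsManifold 𝓘(ℝ, E') ∞ N']
    {h : N → N'} {a : N} {b : N'} {x : E} (hx : x ∈ (extChartAt 𝓘(ℝ, E) a).target)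
    (hh : ContMDiffAt 𝓘(ℝ, E) 𝓘(ℝ, E') ∞ h ((extChartAt 𝓘(ℝ, E) a).symm x))
    (hb : h ((extChartAt 𝓘(ℝ, E) a).symm x) ∈ (extChartAt 𝓘(ℝ, E') b).source) :
    ContDiffAt ℝ 1
      (fun y => extChartAt 𝓘(ℝ, E') b (h ((extChartAt 𝓘(ℝ, E) a).symm y))) x := by
  have h1 : ContMDiffAt 𝓘(ℝ, E) 𝓘(ℝ, E) ∞ (extChartAt 𝓘(ℝ, E) a).symm x :=
    (contMDiffOn_extChartAt_symm a).contMDiffAt ((isOpen_extChartAt_target a).mem_nhds hx)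
  have h2 : ContMDiffAt 𝓘(ℝ, E') 𝓘(ℝ, E') ∞ (extChartAt 𝓘(ℝ, E') b)
      (h ((extChartAt 𝓘(ℝ, E) a).symm x)) :=
    contMDiffAt_extChartAt' (by simpa using hb)
  exact (contMDiffAt_iff_contDiffAt.1 (h2.comp x (hh.comp x h1))).of_le (by simp)

theorem contMDiff_smul_const {E E' G M : Type*}
    [NormedAddCommGroup E] [NormedSpace ℝ E] [NormedAddCommGroup E'] [NormedSpace ℝ E']
    [TopologicalSpace G] [ChartedSpace E' G] [TopologicalSpace M] [ChartedSpace E M]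
    [SMul G M] [ContMDiffSMul 𝓘(ℝ, E') 𝓘(ℝ, E) ∞ G M] (p : M) :
    ContMDiff 𝓘(ℝ, E') 𝓘(ℝ, E) ∞ (fun g : G => g • p) :=
  ContMDiff.smul contMDiff_id contMDiff_const

/-- In charts, the rank of an orbit map near `1` is at most its rank at `1`, by equivariance. -/
theorem finrank_range_fderiv_orbitMap_le
    (EG : Type*) [NormedAddCommGroup EG] [NormedSpace ℝ EG] [FiniteDimensional ℝ EG]
    (E : Type*) [NormedAddCommGroup E] [NormedSpace ℝ E] [FiniteDimensional ℝ E]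
    {G : Type*} [Group G] [TopologicalSpace G] [ChartedSpace EG G] [LieGroup 𝓘(ℝ, EG) ∞ G]
    {M : Type*} [TopologicalSpace M] [ChartedSpace E M] [IsManifold 𝓘(ℝ, E) ∞ M]
    [MulAction G M] [ContMDiffSMul 𝓘(ℝ, EG) 𝓘(ℝ, E) ∞ G M] (p : M) :
    ∀ᶠ x in 𝓝 (extChartAt 𝓘(ℝ, EG) (1 : G) 1),
      Module.finrank ℝ (LinearMap.range (fderiv ℝ (fun y => extChartAt 𝓘(ℝ, E) p
        ((extChartAt 𝓘(ℝ, EG) (1 : G)).symm y • p)) x).toLinearMap) ≤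
      Module.finrank ℝ (LinearMap.range (fderiv ℝ (fun y => extChartAt 𝓘(ℝ, E) p
        ((extChartAt 𝓘(ℝ, EG) (1 : G)).symm y • p))
          (extChartAt 𝓘(ℝ, EG) (1 : G) 1)).toLinearMap) := by
  set φ := extChartAt 𝓘(ℝ, EG) (1 : G) with hφ
  set ψ := extChartAt 𝓘(ℝ, E) p with hψ
  set f := fun y => ψ (φ.symm y • p) with hf
  have hsm := contMDiff_smul_const (E := E) (E' := EG) (G := G) p
  have hφ1 : (1 : G) ∈ φ.source := mem_extChartAt_source 1
  have hφ1' : φ.symm (φ 1) = 1 := φ.left_inv hφ1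
  have hψp : p ∈ ψ.source := mem_extChartAt_source p
  have hψp' : ψ.symm (ψ p) = p := ψ.left_inv hψp
  have htend : Filter.Tendsto φ.symm (𝓝 (φ 1)) (𝓝 1) := by
    have := (continuousAt_extChartAt_symm (I := 𝓘(ℝ, EG)) (1 : G)).tendsto
    rwa [← hφ, hφ1'] at this
  have htendp : Filter.Tendsto (fun g : G => g • p) (𝓝 1) (𝓝 p) := by
    simpa only [one_smul] using hsm.continuous.tendsto 1
  filter_upwards [extChartAt_target_mem_nhds (I := 𝓘(ℝ, EG)) (1 : G),
    (htendp.comp htend).eventually (extChartAt_source_mem_nhds (I := 𝓘(ℝ, E)) p)] with x hx hxp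
  set g := φ.symm x with hg
  -- near `x`, `f = A ∘ f ∘ B`, where `A` is the action of `g`, `B` is multiplication by `g⁻¹`
  set A : E → E := fun e => ψ (g • ψ.symm e) with hA
  set B : EG → EG := fun y => φ (g⁻¹ * φ.symm y) with hB
  have hBx : B x = φ 1 := by simp [hB, ← hg]
  have hfx : f (φ 1) = ψ p := by simp [hf, hφ1']
  have hBd : DifferentiableAt ℝ B x := by
    refine (ContMDiffAt.contDiffAt_extChartAt_comp (h := fun a : G => g⁻¹ * a) hx
      (contMDiff_mul_left.contMDiffAt) ?_).differentiableAt one_ne_zero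
    rw [← hφ, ← hg, inv_mul_cancel]
    exact hφ1
  have hfd : DifferentiableAt ℝ f (φ 1) := by
    refine (ContMDiffAt.contDiffAt_extChartAt_comp (h := fun a : G => a • p)
      (mem_extChartAt_target (1 : G)) hsm.contMDiffAt ?_).differentiableAt one_ne_zero
    rw [← hφ, hφ1', one_smul]
    exact hψp
  have hAd : DifferentiableAt ℝ A (ψ p) := by
    refine (ContMDiffAt.contDiffAt_extChartAt_comp (h := fun q : M => g • q)
      (mem_extChartAt_target p)
      (ContMDiffSMul.contMDiff_const_smul (I := 𝓘(ℝ, EG)) g).contMDiffAt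
      ?_).differentiableAt one_ne_zero
    rw [← hψ, hψp']
    exact hxp
  have hgtend : Filter.Tendsto (fun y => g⁻¹ * φ.symm y) (𝓝 x) (𝓝 1) := by
    have h1 : ContinuousAt φ.symm x := continuousAt_extChartAt_symm'' hx
    have h2 : Continuous (fun a : G => g⁻¹ * a) :=
      (contMDiff_mul_left (I := 𝓘(ℝ, EG)) (n := ∞)).continuous
    have h3 := (h2.tendsto (φ.symm x)).comp h1.tendsto
    rwa [← hg, inv_mul_cancel] at h3
  have hev : f =ᶠ[𝓝 x] A ∘ f ∘ B := by
    filter_upwards [hgtend.eventually (extChartAt_source_mem_nhds (I := 𝓘(ℝ, EG)) (1 : G)),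
      (htendp.comp hgtend).eventually (extChartAt_source_mem_nhds (I := 𝓘(ℝ, E)) p)] with y h1 h2
    have h3 : φ.symm (φ (g⁻¹ * φ.symm y)) = g⁻¹ * φ.symm y := φ.left_inv h1
    have h4 : ψ.symm (ψ ((g⁻¹ * φ.symm y) • p)) = (g⁻¹ * φ.symm y) • p := ψ.left_inv h2
    simp only [hf, hA, hB, Function.comp_apply, h3, h4, smul_smul, mul_inv_cancel_left]
  have hd : fderiv ℝ f x = fderiv ℝ A (ψ p) ∘L (fderiv ℝ f (φ 1) ∘L fderiv ℝ B x) := by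
    rw [hev.fderiv_eq, fderiv_comp x (by rw [Function.comp_apply, hBx, hfx]; exact hAd)
      (by exact DifferentiableAt.comp x (by rwa [hBx]) hBd), fderiv_comp x (by rwa [hBx]) hBd,
      Function.comp_apply, hBx, hfx]
  rw [hd]
  calc _ ≤ Module.finrank ℝ (LinearMap.range
        (fderiv ℝ f (φ 1) ∘L fderiv ℝ B x).toLinearMap) := by
        rw [ContinuousLinearMap.toLinearMap_comp, LinearMap.range_comp]
        exact Submodule.finrank_map_le _ _
    _ ≤ _ := by
        rw [ContinuousLinearMap.toLinearMap_comp]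
        exact Submodule.finrank_mono (LinearMap.range_comp_le_range _ _)

/-- The projection of a Lie group onto the quotient by an isotropy group of a smooth action has a
continuous section near the identity coset: the orbit map has constant rank. -/
theorem exists_local_section_quotient_stabilizer
    (EG : Type*) [NormedAddCommGroup EG] [NormedSpace ℝ EG] [FiniteDimensional ℝ EG]
    (E : Type*) [NormedAddCommGroup E] [NormedSpace ℝ E] [FiniteDimensional ℝ E]
    {G : Type*} [Group G] [TopologicalSpace G] [ChartedSpace EG G] [LieGroup 𝓘(ℝ, EG) ∞ G]
    {M : Type*} [TopologicalSpace M] [ChartedSpace E M] [IsManifold 𝓘(ℝ, E) ∞ M]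
    [MulAction G M] [ContMDiffSMul 𝓘(ℝ, EG) 𝓘(ℝ, E) ∞ G M] (p : M) :
    ∃ σ : G ⧸ MulAction.stabilizer G p → G,
      ∃ U ∈ 𝓝 ((1 : G) : G ⧸ MulAction.stabilizer G p), ContinuousOn σ U ∧
        ∀ u ∈ U, (σ u : G ⧸ MulAction.stabilizer G p) = u := by
  have : IsTopologicalGroup G := topologicalGroup_of_lieGroup 𝓘(ℝ, EG) ∞
  set φ := extChartAt 𝓘(ℝ, EG) (1 : G) with hφ
  set ψ := extChartAt 𝓘(ℝ, E) p with hψ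
  have hsm := contMDiff_smul_const (E := E) (E' := EG) (G := G) p
  have hφ1 : (1 : G) ∈ φ.source := mem_extChartAt_source 1
  have hφ1' : φ.symm (φ 1) = 1 := φ.left_inv hφ1
  have hψp : p ∈ ψ.source := mem_extChartAt_source p
  have htendp : Filter.Tendsto (fun g : G => g • p) (𝓝 1) (𝓝 p) := by
    simpa only [one_smul] using hsm.continuous.tendsto 1
  have hfd : ContDiffAt ℝ 1 (fun y => ψ (φ.symm y • p)) (φ 1) := by
    refine ContMDiffAt.contDiffAt_extChartAt_comp (h := fun a : G => a • p)
      (mem_extChartAt_target (1 : G)) hsm.contMDiffAt ?_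
    rw [← hφ, hφ1', one_smul]
    exact hψp
  obtain ⟨s, hs0, hsc, hs⟩ :=
    hfd.exists_section_of_finrank_le (finrank_range_fderiv_orbitMap_le EG E p)
  simp only [hφ1', one_smul] at hs0 hsc
  have hψt : Filter.Tendsto (fun g : G => ψ (g • p)) (𝓝 1) (𝓝 (ψ p)) :=
    (continuousAt_extChartAt (I := 𝓘(ℝ, E)) p).tendsto.comp htendp
  have hst : Filter.Tendsto (fun g : G => s (ψ (g • p))) (𝓝 1) (𝓝 (φ 1)) := by
    have := hsc.self_of_nhds.tendsto
    rw [hs0] at this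
    exact this.comp hψt
  have hφt : Filter.Tendsto (fun g : G => φ.symm (s (ψ (g • p)))) (𝓝 1) (𝓝 1) := by
    have := (continuousAt_extChartAt_symm (I := 𝓘(ℝ, EG)) (1 : G)).tendsto
    rw [← hφ, hφ1'] at this
    exact this.comp hst
  set j : G ⧸ MulAction.stabilizer G p → M := MulAction.ofQuotientStabilizer G p with hj
  have hjc : Continuous j := continuous_quot_lift _ hsm.continuous
  have hgood : ∀ᶠ g in 𝓝 (1 : G), g • p ∈ ψ.source ∧ ContinuousAt s (ψ (g • p)) ∧
      s (ψ (g • p)) ∈ φ.target ∧ φ.symm (s (ψ (g • p))) • p ∈ ψ.source ∧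
      ψ (φ.symm (s (ψ (g • p))) • p) = ψ (g • p) := by
    filter_upwards [htendp.eventually (extChartAt_source_mem_nhds (I := 𝓘(ℝ, E)) p),
      hψt.eventually hsc, hst.eventually (extChartAt_target_mem_nhds (I := 𝓘(ℝ, EG)) (1 : G)),
      (htendp.comp hφt).eventually (extChartAt_source_mem_nhds (I := 𝓘(ℝ, E)) p),
      (continuousAt_extChartAt (I := 𝓘(ℝ, EG)) (1 : G)).eventually hs,
      extChartAt_source_mem_nhds (I := 𝓘(ℝ, EG)) (1 : G)] with g h1 h2 h3 h4 h5 h6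
    rw [← hφ, φ.left_inv h6] at h5
    exact ⟨h1, h2, h3, h4, h5⟩
  refine ⟨fun u => φ.symm (s (ψ (j u))), _,
    QuotientGroup.isOpenMap_coe.image_mem_nhds hgood, ?_, ?_⟩
  · rintro _ ⟨g, ⟨h1, h2, h3, -, -⟩, rfl⟩
    have hψj : ContinuousAt (fun u => ψ (j u)) (g : G ⧸ MulAction.stabilizer G p) :=
      ContinuousAt.comp (f := j) (continuousAt_extChartAt' h1) hjc.continuousAt
    have hsj : ContinuousAt (fun u => s (ψ (j u))) (g : G ⧸ MulAction.stabilizer G p) :=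
      ContinuousAt.comp (f := fun u => ψ (j u)) h2 hψj
    exact (ContinuousAt.comp (f := fun u => s (ψ (j u)))
      (continuousAt_extChartAt_symm'' h3) hsj).continuousWithinAt
  · rintro _ ⟨g, ⟨h1, -, -, h4, h5⟩, rfl⟩
    exact MulAction.injective_ofQuotientStabilizer G p (ψ.injOn h4 h1 h5)

/-! ### Lifting maps of a square through `G → G ⧸ H` -/

section Lifting

variable {G : Type*} [Group G] [TopologicalSpace G] {H : Subgroup G}

/-- The map `F` into `G ⧸ H` lifts over the set `S` to `G`. The lift is required to be defined and
continuous on the whole space; it projects to `F` only over `S`. -/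
def LiftsOn {X : Type*} [TopologicalSpace X] (F : X → G ⧸ H) (S : Set X) : Prop :=
  ∃ f : X → G, Continuous f ∧ ∀ x ∈ S, (f x : G ⧸ H) = F x

theorem LiftsOn.mono {X : Type*} [TopologicalSpace X] {F : X → G ⧸ H} {S T : Set X}
    (h : LiftsOn F T) (hST : S ⊆ T) : LiftsOn F S :=
  let ⟨f, hf, hfT⟩ := h
  ⟨f, hf, fun x hx => hfT x (hST hx)⟩

/-- Lifts over two sets separated by the level `u = b` can be glued if `ρ` retracts the second set
onto the intersection: over the second set the lift is corrected by an `H`-valued function, which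
extends from the intersection by means of `ρ`. -/
theorem LiftsOn.glue [IsTopologicalGroup G] {X : Type*} [TopologicalSpace X] {F : X → G ⧸ H}
    {A B : Set X} (hA : LiftsOn F A) (hB : LiftsOn F B) {u : X → ℝ} (hu : Continuous u) (b : ℝ)
    {ρ : X → X} (hρ : Continuous ρ) (hρu : ∀ x, u x = b → ρ x = x)
    (hAB : ∀ x ∈ B, b ≤ u x → ρ x ∈ A ∩ B) :
    LiftsOn F {x | (x ∈ A ∧ u x ≤ b) ∨ (x ∈ B ∧ b ≤ u x)} := by
  obtain ⟨f, hf, hfA⟩ := hA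
  obtain ⟨g, hg, hgB⟩ := hB
  have key (x : X) (hx : x ∈ B) (hbx : b ≤ u x) :
      ((g x * ((g (ρ x))⁻¹ * f (ρ x)) : G) : G ⧸ H) = F x := by
    obtain ⟨h1, h2⟩ := hAB x hx hbx
    rw [← hgB x hx, eq_comm, QuotientGroup.eq, inv_mul_cancel_left, ← QuotientGroup.eq,
      hgB _ h2, hfA _ h1]
  refine ⟨fun x => if u x ≤ b then f x else g x * ((g (ρ x))⁻¹ * f (ρ x)),
    Continuous.if_le hf (by fun_prop) hu continuous_const fun x hx => ?_, ?_⟩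
  · simp [hρu x hx]
  · rintro x (⟨hx, hxb⟩ | ⟨hx, hxb⟩)
    · simp only [if_pos hxb, hfA x hx]
    · rcases hxb.lt_or_eq with h | h
      · simp only [if_neg h.not_ge, key x hx hxb]
      · have := (hAB x hx hxb).1
        rw [hρu x h.symm] at this
        simp only [if_pos h.ge, hfA x this]

theorem LiftsOn.glue_fst [IsTopologicalGroup G] {F : ℝ × ℝ → G ⧸ H} {a b b' : ℝ} {S : Set ℝ}
    (hab : a ≤ b) (hbb' : b ≤ b') (h₁ : LiftsOn F (Set.Icc a b ×ˢ S))
    (h₂ : LiftsOn F (Set.Icc b b' ×ˢ S)) : LiftsOn F (Set.Icc a b' ×ˢ S) := by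
  refine (h₁.glue h₂ continuous_fst b (ρ := fun x => (b, x.2)) (by fun_prop)
    (fun x hx => by rw [← hx]) ?_).mono ?_
  · rintro x ⟨h1, h2⟩ -
    exact ⟨⟨⟨hab, le_rfl⟩, h2⟩, ⟨le_rfl, hbb'⟩, h2⟩
  · rintro x ⟨h1, h2⟩
    rcases le_total x.1 b with h | h
    · exact Or.inl ⟨⟨⟨h1.1, h⟩, h2⟩, h⟩
    · exact Or.inr ⟨⟨⟨h, h1.2⟩, h2⟩, h⟩

theorem LiftsOn.glue_snd [IsTopologicalGroup G] {F : ℝ × ℝ → G ⧸ H} {a b b' : ℝ} {S : Set ℝ}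
    (hab : a ≤ b) (hbb' : b ≤ b') (h₁ : LiftsOn F (S ×ˢ Set.Icc a b))
    (h₂ : LiftsOn F (S ×ˢ Set.Icc b b')) : LiftsOn F (S ×ˢ Set.Icc a b') := by
  refine (h₁.glue h₂ continuous_snd b (ρ := fun x => (x.1, b)) (by fun_prop)
    (fun x hx => by rw [← hx]) ?_).mono ?_
  · rintro x ⟨h1, h2⟩ -
    exact ⟨⟨h1, ⟨hab, le_rfl⟩⟩, h1, ⟨le_rfl, hbb'⟩⟩
  · rintro x ⟨h1, h2⟩
    rcases le_total x.2 b with h | h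
    · exact Or.inl ⟨⟨h1, ⟨h2.1, h⟩⟩, h⟩
    · exact Or.inr ⟨⟨h1, ⟨h, h2.2⟩⟩, h⟩

/-- A local section near the identity coset, translated, gives lifts over small squares. -/
theorem exists_liftsOn_closedBall [IsTopologicalGroup G] {σ : G ⧸ H → G} {U : Set (G ⧸ H)}
    (hU : U ∈ 𝓝 ((1 : G) : G ⧸ H)) (hσ : ContinuousOn σ U) (hσU : ∀ u ∈ U, (σ u : G ⧸ H) = u)
    {F : ℝ × ℝ → G ⧸ H} (hF : Continuous F) (x₀ : ℝ × ℝ) :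
    ∃ δ > 0, LiftsOn F (Metric.closedBall x₀ δ) := by
  obtain ⟨g, hg⟩ := QuotientGroup.mk_surjective (F x₀)
  have hgF : Continuous fun x => g⁻¹ • F x := hF.const_smul g⁻¹
  have hmem : (fun x => g⁻¹ • F x) ⁻¹' U ∈ 𝓝 x₀ := by
    refine hgF.continuousAt.preimage_mem_nhds ?_
    rw [← hg, MulAction.Quotient.smul_coe, smul_eq_mul, inv_mul_cancel]
    exact hU
  obtain ⟨δ, hδ, hball⟩ := Metric.nhds_basis_closedBall.mem_iff.1 hmem
  have hIcc (a : ℝ) : a - δ ≤ a + δ := by linarith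
  have hset : Metric.closedBall x₀ δ =
      Set.Icc (x₀.1 - δ) (x₀.1 + δ) ×ˢ Set.Icc (x₀.2 - δ) (x₀.2 + δ) := by
    rw [← Real.closedBall_eq_Icc, ← Real.closedBall_eq_Icc, closedBall_prod_same]
  -- the retraction of the plane onto the square
  set c : ℝ × ℝ → ℝ × ℝ := fun x =>
    (Set.projIcc _ _ (hIcc x₀.1) x.1, Set.projIcc _ _ (hIcc x₀.2) x.2) with hc
  have hcc : Continuous c :=
    (continuous_subtype_val.comp (continuous_projIcc.comp continuous_fst)).prodMk
      (continuous_subtype_val.comp (continuous_projIcc.comp continuous_snd))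
  have hcU (x : ℝ × ℝ) : g⁻¹ • F (c x) ∈ U := by
    refine hball ?_
    rw [hset]
    exact ⟨Subtype.prop _, Subtype.prop _⟩
  refine ⟨δ, hδ, fun x => g * σ (g⁻¹ • F (c x)), continuous_const.mul
    (hσ.comp_continuous (hgF.comp hcc) hcU), fun x hx => ?_⟩
  have hcx : c x = x := by
    rw [hset] at hx
    exact Prod.ext (congrArg Subtype.val (Set.projIcc_of_mem (hIcc x₀.1) hx.1))
      (congrArg Subtype.val (Set.projIcc_of_mem (hIcc x₀.2) hx.2))
  change ((g • σ (g⁻¹ • F (c x)) : G) : G ⧸ H) = F x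
  rw [← MulAction.Quotient.smul_coe, hσU _ (hcU x), smul_inv_smul, hcx]

/-- If `G → G ⧸ H` has a local section, every map of a square into `G ⧸ H` lifts to `G`: the square
is cut into small cells over which there are lifts, and these are glued cell by cell and then row by
row. -/
theorem exists_lift_square [IsTopologicalGroup G] {σ : G ⧸ H → G} {U : Set (G ⧸ H)}
    (hU : U ∈ 𝓝 ((1 : G) : G ⧸ H)) (hσ : ContinuousOn σ U) (hσU : ∀ u ∈ U, (σ u : G ⧸ H) = u)
    {F : ℝ × ℝ → G ⧸ H} (hF : Continuous F) :
    LiftsOn F (Set.Icc 0 1 ×ˢ Set.Icc 0 1) := by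
  choose δ hδ hlift using exists_liftsOn_closedBall hU hσ hσU hF
  obtain ⟨ε, hε, hleb⟩ := lebesgue_number_lemma_of_metric
    (isCompact_Icc.prod isCompact_Icc : IsCompact (Set.Icc (0 : ℝ) 1 ×ˢ Set.Icc (0 : ℝ) 1))
    (c := fun x => Metric.ball x (δ x)) (fun x => Metric.isOpen_ball)
    (fun x _ => Set.mem_iUnion.2 ⟨x, Metric.mem_ball_self (hδ x)⟩)
  obtain ⟨n, hn⟩ := exists_nat_one_div_lt hε
  set N : ℝ := n + 1 with hN
  have hN0 : 0 < N := by positivity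
  have hdiv (k : ℕ) : (k : ℝ) / N ≤ (k + 1) / N := by gcongr; linarith
  have hcell (i j : ℕ) (hi : i ≤ n) (hj : j ≤ n) :
      LiftsOn F (Set.Icc (i / N) ((i + 1) / N) ×ˢ Set.Icc (j / N) ((j + 1) / N)) := by
    have hIcc (i : ℕ) (hi : i ≤ n) : (i : ℝ) / N ∈ Set.Icc (0 : ℝ) 1 := by
      refine ⟨by positivity, (div_le_one hN0).2 ?_⟩
      have : (i : ℝ) ≤ n := by exact_mod_cast hi
      linarith
    obtain ⟨x, hx⟩ := hleb (i / N, j / N) ⟨hIcc i hi, hIcc j hj⟩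
    refine (hlift x).mono (Set.Subset.trans ?_ (hx.trans Metric.ball_subset_closedBall))
    rintro y ⟨⟨h1, h2⟩, h3, h4⟩
    rw [add_div] at h2 h4
    rw [Metric.mem_ball, Prod.dist_eq, max_lt_iff, Real.dist_eq, Real.dist_eq, abs_lt, abs_lt]
    exact ⟨⟨by linarith, by linarith⟩, by linarith, by linarith⟩
  have hrow (j : ℕ) (hj : j ≤ n) (k : ℕ) : k ≤ n →
      LiftsOn F (Set.Icc 0 ((k + 1) / N) ×ˢ Set.Icc (j / N) ((j + 1) / N)) := by
    induction k with
    | zero => intro hk; simpa using hcell 0 j hk hj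
    | succ k ih =>
      intro hk
      have := hcell (k + 1) j hk hj
      push_cast at this ⊢
      exact (ih (by omega)).glue_fst (by positivity) (by gcongr; linarith) this
  have hall (k : ℕ) : k ≤ n →
      LiftsOn F (Set.Icc 0 1 ×ˢ Set.Icc 0 ((k + 1) / N)) := by
    have hone : ((n : ℝ) + 1) / N = 1 := div_self hN0.ne'
    induction k with
    | zero => intro hk; simpa [hone] using hrow 0 hk n le_rfl
    | succ k ih =>
      intro hk
      have := hrow (k + 1) hk n le_rfl
      rw [hone] at this
      push_cast at this ⊢
      exact (ih (by omega)).glue_snd (by positivity) (by gcongr; linarith) this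
  simpa only [← hN, div_self hN0.ne'] using hall n le_rfl

end Lifting

/-! ### Exactness of `π₁(H / K) → π₁(G / K) → π₁(G / H) → 1` -/

namespace CohomOne

open scoped unitInterval

section Exact

variable {G : Type*} [Group G] [TopologicalSpace G] {H K : Subgroup G}

theorem incl_mk (a : H) : incl H K (a : H ⧸ K.subgroupOf H) = ((a : G) : G ⧸ K) := rfl

theorem proj_mk (h : K ≤ H) (a : G) : proj h (a : G ⧸ K) = (a : G ⧸ H) := rfl

theorem proj_incl (h : K ≤ H) (x : H ⧸ K.subgroupOf H) :
    proj h (incl H K x) = ((1 : G) : G ⧸ H) := by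
  obtain ⟨a, rfl⟩ := QuotientGroup.mk_surjective x
  rw [incl_mk, proj_mk, eq_comm, QuotientGroup.eq, inv_one, one_mul]
  exact a.2

theorem exists_incl_eq (h : K ≤ H) {y : G ⧸ K} (hy : proj h y = ((1 : G) : G ⧸ H)) :
    ∃ x, incl H K x = y := by
  obtain ⟨g, rfl⟩ := QuotientGroup.mk_surjective y
  rw [proj_mk, eq_comm, QuotientGroup.eq, inv_one, one_mul] at hy
  exact ⟨((⟨g, hy⟩ : H) : H ⧸ K.subgroupOf H), rfl⟩

/-- Moving a point `y` of `G ⧸ K` by `g * g'⁻¹`, where `g'` lies over the image of `y` in `G ⧸ H`,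
gives a point over the coset of `g`. This turns lifts to `G` into lifts to `G ⧸ K` with a prescribed
initial value. -/
theorem proj_smul_inv_smul (h : K ≤ H) {y : G ⧸ K} {g' : G} (hy : (g' : G ⧸ H) = proj h y)
    (g : G) : proj h (g • g'⁻¹ • y) = (g : G ⧸ H) := by
  obtain ⟨a, rfl⟩ := QuotientGroup.mk_surjective y
  rw [proj_mk, QuotientGroup.eq] at hy
  rw [MulAction.Quotient.smul_coe, MulAction.Quotient.smul_coe, proj_mk, eq_comm,
    QuotientGroup.eq]
  simpa using hy

/-- No closedness of `H` or `K` is needed: an open quotient map restricts to a quotient map on a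
saturated set. -/
theorem isEmbedding_incl [IsTopologicalGroup G] (hKH : K ≤ H) :
    Topology.IsEmbedding (incl H K) := by
  refine ⟨⟨le_antisymm (incl H K).continuous.le_induced fun V hV => ?_⟩, ?_⟩
  · obtain ⟨O, hO, hOV⟩ :=
      isOpen_induced_iff.1 (hV.preimage (continuous_quotient_mk' (s := _)) :
        IsOpen ((fun a : H => (a : H ⧸ K.subgroupOf H)) ⁻¹' V))
    -- `V` is cut out by the image of `O`, since `O` meets a coset of `K` in `H` inside `H`
    refine isOpen_induced_iff.2 ⟨_, QuotientGroup.isOpenMap_coe (N := K) O hO, ?_⟩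
    ext x
    obtain ⟨a, rfl⟩ := QuotientGroup.mk_surjective x
    have hmem (b : H) : (b : G) ∈ O ↔ (b : H ⧸ K.subgroupOf H) ∈ V := Set.ext_iff.1 hOV b
    constructor
    · rintro ⟨o, ho, hoa⟩
      have hK : o⁻¹ * a ∈ K := QuotientGroup.eq.1 hoa
      have hoH : o ∈ H := by
        simpa using H.mul_mem a.2 (H.inv_mem (hKH hK))
      rwa [← show ((⟨o, hoH⟩ : H) : H ⧸ K.subgroupOf H) = a from QuotientGroup.eq.2 hK, ← hmem]
    · exact fun ha => ⟨a, (hmem a).2 ha, rfl⟩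
  · intro x y hxy
    obtain ⟨a, rfl⟩ := QuotientGroup.mk_surjective x
    obtain ⟨b, rfl⟩ := QuotientGroup.mk_surjective y
    rw [incl_mk, incl_mk, QuotientGroup.eq] at hxy
    exact QuotientGroup.eq.2 hxy

/-- A loop in `G / K` all of whose points lie over the base point of `G / H` is a loop in
`H / K`. -/
theorem exists_path_incl_eq [IsTopologicalGroup G] (h : K ≤ H)
    (c : Path ((1 : G) : G ⧸ K) ((1 : G) : G ⧸ K))
    (hc : ∀ t, proj h (c t) = ((1 : G) : G ⧸ H)) :
    ∃ δ : Path ((1 : H) : H ⧸ K.subgroupOf H) ((1 : H) : H ⧸ K.subgroupOf H),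
      ∀ t, incl H K (δ t) = c t := by
  choose δ hδ using fun t => exists_incl_eq h (hc t)
  have hemb := isEmbedding_incl h
  exact ⟨⟨⟨δ, hemb.continuous_iff.2 (by simpa only [Function.comp_def, hδ] using c.continuous)⟩,
    hemb.injective (by rw [hδ, c.source]; rfl), hemb.injective (by rw [hδ, c.target]; rfl)⟩, hδ⟩

/-- Every loop in `G ⧸ H` lifts, up to homotopy, to a loop in `G ⧸ K`: a lift to `G` gives a path
in `G ⧸ K` that starts at the base point and ends in `H ⧸ K`, where it can be closed up. -/
theorem exists_path_proj_homotopic [IsTopologicalGroup G] (h : K ≤ H)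
    [PathConnectedSpace (H ⧸ K.subgroupOf H)]
    (hlift : ∀ F : ℝ × ℝ → G ⧸ H, Continuous F → LiftsOn F (Set.Icc 0 1 ×ˢ Set.Icc 0 1))
    (β : Path ((1 : G) : G ⧸ H) ((1 : G) : G ⧸ H)) :
    ∃ α : Path ((1 : G) : G ⧸ K) ((1 : G) : G ⧸ K),
      (α.map (proj h).continuous).Homotopic β := by
  obtain ⟨f, hf, hfβ⟩ := hlift (fun x => β.extend x.1) (β.continuous_extend.comp continuous_fst)
  have hfβ' (t : I) : (f (t, 0) : G ⧸ H) = β t := by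
    exact (hfβ (t, 0) ⟨t.2, by simp⟩).trans (β.extend_apply t.2)
  have h0 : f ((0 : I), 0) ∈ H := by
    simpa [β.source, eq_comm (b := ((1 : G) : G ⧸ H)), QuotientGroup.eq] using hfβ' 0
  have h1 : f ((1 : I), 0) ∈ H := by
    simpa [β.target, eq_comm (b := ((1 : G) : G ⧸ H)), QuotientGroup.eq] using hfβ' 1
  set b : H := ⟨_, h1⟩ * ⟨_, h0⟩⁻¹ with hb
  -- the lift of `β` to `G` that starts at `1`; it ends at a point `b` of `H`
  let α₁ : Path ((1 : G) : G ⧸ K) ((b : G) : G ⧸ K) :=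
    { toFun := fun t => ((f (t, 0) * (f ((0 : I), 0))⁻¹ : G) : G ⧸ K)
      continuous_toFun := by
        refine (continuous_quotient_mk' : Continuous (fun a : G => (a : G ⧸ K))).comp ?_
        fun_prop
      source' := by simp
      target' := rfl }
  let δ : Path (b : H ⧸ K.subgroupOf H) ((1 : H) : H ⧸ K.subgroupOf H) :=
    PathConnectedSpace.somePath _ _
  let δ' : Path ((b : G) : G ⧸ K) ((1 : G) : G ⧸ K) := δ.map (incl H K).continuous
  have hα₁ (t : I) : proj h (α₁ t) = β t := by
    change ((f (t, 0) * (f ((0 : I), 0))⁻¹ : G) : G ⧸ H) = β t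
    rw [← hfβ' t, eq_comm, QuotientGroup.eq, inv_mul_cancel_left]
    exact H.inv_mem h0
  have hδ' (t : I) : proj h (δ' t) = ((1 : G) : G ⧸ H) := proj_incl h _
  refine ⟨α₁.trans δ', ?_⟩
  suffices (α₁.trans δ').map (proj h).continuous = β.trans (Path.refl _) from
    this ▸ ⟨Path.Homotopy.transRefl β⟩
  ext t
  change proj h ((α₁.trans δ') t) = (β.trans (Path.refl _)) t
  rw [Path.trans_apply, Path.trans_apply]
  split_ifs
  · exact hα₁ _
  · exact hδ' _

/-- A loop in `G ⧸ K` that is null-homotopic in `G ⧸ H` is homotopic to a loop in `H ⧸ K`. Lifting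
the null-homotopy gives a square in `G ⧸ K` with the loop on one side and the three other sides
in `H ⧸ K`. -/
theorem exists_path_incl_homotopic [IsTopologicalGroup G] (h : K ≤ H)
    (hlift : ∀ F : ℝ × ℝ → G ⧸ H, Continuous F → LiftsOn F (Set.Icc 0 1 ×ˢ Set.Icc 0 1))
    (α : Path ((1 : G) : G ⧸ K) ((1 : G) : G ⧸ K))
    (hα : (α.map (proj h).continuous).Homotopic (Path.refl _)) :
    ∃ δ : Path ((1 : H) : H ⧸ K.subgroupOf H) ((1 : H) : H ⧸ K.subgroupOf H),
      Path.Homotopic (x₀ := ((1 : G) : G ⧸ K)) (x₁ := ((1 : G) : G ⧸ K))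
        (δ.map (incl H K).continuous) α := by
  obtain ⟨Φ⟩ := hα
  obtain ⟨f, hf, hfΦ⟩ := hlift
    (fun x => Φ (Set.projIcc 0 1 zero_le_one x.1, Set.projIcc 0 1 zero_le_one x.2)) (by fun_prop)
  have hfΦ' (t s : I) : (f (t, s) : G ⧸ H) = Φ (t, s) := by
    rw [hfΦ _ ⟨t.2, s.2⟩]; simp
  -- a homotopy in `G / K` that lifts `Φ` and starts at `α`
  let S : C(I × I, G ⧸ K) :=
    ⟨fun x => f (x.1, x.2) • (f ((0 : I), x.2))⁻¹ • α x.2, by fun_prop⟩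
  have hS0 (s : I) : S (0, s) = α s := smul_inv_smul _ _
  have hS (t s : I) : proj h (S (t, s)) = Φ (t, s) := by
    rw [← hfΦ' t s]
    refine proj_smul_inv_smul h ?_ _
    rw [hfΦ', Φ.apply_zero]; rfl
  -- one side of the square and the other three sides are homotopic in the square
  let c₁ : Path ((0, 0) : I × I) (0, 1) := (Path.refl 0).prod Path.id
  let c₂ : Path ((0, 0) : I × I) (0, 1) :=
    ((Path.id.prod (Path.refl 0)).trans ((Path.refl 1).prod Path.id)).trans
      (Path.id.symm.prod (Path.refl 1))
  have hc₂ (t : I) : proj h (S (c₂ t)) = ((1 : G) : G ⧸ H) := by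
    have : c₂ t ∈ {x : I × I | Φ x = ((1 : G) : G ⧸ H)} := by
      revert t
      rw [← Set.range_subset_iff]
      simp only [c₂, Path.trans_range, Set.union_subset_iff, Set.range_subset_iff]
      refine ⟨⟨fun t => ?_, fun t => ?_⟩, fun t => ?_⟩
      · exact (Φ.source t).trans rfl
      · exact Φ.apply_one t
      · exact Φ.target _
    rw [hS]; exact this
  have : ContractibleSpace I := (convex_Icc 0 1).contractibleSpace ⟨0, by simp⟩
  have : SimplyConnectedSpace (I × I) := SimplyConnectedSpace.ofContractible _
  have hc : c₁.Homotopic c₂ := SimplyConnectedSpace.paths_homotopic _ _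
  have hS00 : ((1 : G) : G ⧸ K) = S (0, 0) := ((hS0 0).trans α.source).symm
  have hS01 : ((1 : G) : G ⧸ K) = S (0, 1) := ((hS0 1).trans α.target).symm
  obtain ⟨δ, hδ⟩ := exists_path_incl_eq h ((c₂.map S.continuous).cast hS00 hS01) hc₂
  refine ⟨δ, ?_⟩
  have h₁ : (c₁.map S.continuous).cast hS00 hS01 = α := by
    ext t; exact hS0 t
  have h₂ : (c₂.map S.continuous).cast hS00 hS01 = δ.map (incl H K).continuous := by
    ext t; exact (hδ t).symm
  have := ((hc.map S).pathCast hS00 hS01).symm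
  rwa [h₁, h₂] at this

theorem projHom_mk (h : K ≤ H) (α : Path ((1 : G) : G ⧸ K) ((1 : G) : G ⧸ K)) :
    projHom h (.mk α) = .mk (α.map (proj h).continuous) :=
  FundamentalGroup.mapOfEq_apply ..

theorem inclHom_mk (δ : Path ((1 : H) : H ⧸ K.subgroupOf H) ((1 : H) : H ⧸ K.subgroupOf H)) :
    inclHom H K (.mk δ) = .mk (δ.map (incl H K).continuous) :=
  FundamentalGroup.mapOfEq_apply ..

theorem ker_projHom [IsTopologicalGroup G] (h : K ≤ H)
    (hlift : ∀ F : ℝ × ℝ → G ⧸ H, Continuous F → LiftsOn F (Set.Icc 0 1 ×ˢ Set.Icc 0 1)) :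
    (projHom h).ker = (inclHom H K).range := by
  ext p
  obtain ⟨α, rfl⟩ := Path.Homotopic.Quotient.mk_surjective p
  rw [MonoidHom.mem_ker, MonoidHom.mem_range, projHom_mk]
  constructor
  · intro hα
    obtain ⟨δ, hδ⟩ := exists_path_incl_homotopic h hlift α (Path.Homotopic.Quotient.exact hα)
    exact ⟨.mk δ, (inclHom_mk δ).trans (Path.Homotopic.Quotient.eq.2 hδ)⟩
  · rintro ⟨q, hq⟩
    obtain ⟨δ, rfl⟩ := Path.Homotopic.Quotient.mk_surjective q
    rw [← projHom_mk, ← hq, inclHom_mk]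
    refine (projHom_mk h (δ.map (incl H K).continuous)).trans
      (congrArg Path.Homotopic.Quotient.mk ?_)
    ext t
    exact proj_incl h _

theorem projHom_surjective [IsTopologicalGroup G] (h : K ≤ H)
    [PathConnectedSpace (H ⧸ K.subgroupOf H)]
    (hlift : ∀ F : ℝ × ℝ → G ⧸ H, Continuous F → LiftsOn F (Set.Icc 0 1 ×ˢ Set.Icc 0 1)) :
    Function.Surjective (projHom h) := by
  intro p
  obtain ⟨β, rfl⟩ := Path.Homotopic.Quotient.mk_surjective p
  obtain ⟨α, hα⟩ := exists_path_proj_homotopic h hlift β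
  exact ⟨.mk α, (projHom_mk h α).trans (Path.Homotopic.Quotient.eq.2 hα)⟩

theorem range_sphereHom {S : Type*} [TopologicalSpace S] (e : S ≃ₜ H ⧸ K.subgroupOf H) :
    (sphereHom e).range = (inclHom H K).range := by
  have hmk (γ : Path (e.symm ((1 : H) : H ⧸ K.subgroupOf H))
        (e.symm ((1 : H) : H ⧸ K.subgroupOf H)))
      (δ : Path ((1 : H) : H ⧸ K.subgroupOf H) ((1 : H) : H ⧸ K.subgroupOf H))
      (hγδ : ∀ t, e (γ t) = δ t) : sphereHom e (.mk γ) = inclHom H K (.mk δ) := by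
    rw [inclHom_mk]
    refine (FundamentalGroup.mapOfEq_apply ((incl H K).comp (e : C(S, H ⧸ K.subgroupOf H)))
      (congrArg (incl H K) (e.apply_symm_apply _)) (.mk γ)).trans
      (congrArg Path.Homotopic.Quotient.mk ?_)
    ext t
    exact congrArg (incl H K) (hγδ t)
  ext p
  constructor
  · rintro ⟨q, rfl⟩
    obtain ⟨γ, rfl⟩ := Path.Homotopic.Quotient.mk_surjective q
    exact ⟨.mk ((γ.map e.continuous).cast (e.apply_symm_apply _).symm (e.apply_symm_apply _).symm),
      (hmk _ _ fun t => rfl).symm⟩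
  · rintro ⟨q, rfl⟩
    obtain ⟨δ, rfl⟩ := Path.Homotopic.Quotient.mk_surjective q
    exact ⟨.mk (δ.map e.symm.continuous), hmk _ _ fun t => e.apply_symm_apply _⟩

end Exact

end CohomOne

/-! ### Deformation of the manifold onto its singular orbit -/

/-- A map on `X` is continuous if its value at `x` is a continuous function of `x` and of any
point `c` of a compact space which stands in a closed relation to `x`. With the compact group `C =
G`, this replaces the fact that `G × [0, L) → M`, `(g, t) ↦ g • γ t`, is a quotient map. -/
theorem continuous_of_isClosed_rel_of_compact {C X Y : Type*} [TopologicalSpace C]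
    [CompactSpace C] [TopologicalSpace X] [TopologicalSpace Y] {r : Set (C × X)}
    (hr : IsClosed r) (hex : ∀ x, ∃ c, (c, x) ∈ r) {F : C × X → Y} (hF : Continuous F)
    {f : X → Y} (hf : ∀ c x, (c, x) ∈ r → f x = F (c, x)) : Continuous f := by
  refine continuous_iff_isClosed.2 fun T hT => ?_
  convert isClosedMap_snd_of_compactSpace _ (hr.inter (hT.preimage hF))
  ext x
  simp only [Set.mem_preimage, Set.mem_image, Set.mem_inter_iff, Prod.exists, exists_eq_right]
  constructor
  · intro hx
    obtain ⟨c, hc⟩ := hex x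
    exact ⟨c, hc, hf c x hc ▸ hx⟩
  · rintro ⟨c, hc, hx⟩
    exact (hf c x hc).symm ▸ hx

/-- A homotopy equivalence induces isomorphisms of fundamental groups. -/
noncomputable def ContinuousMap.HomotopyEquiv.fundamentalGroupMulEquiv {X Y : Type*}
    [TopologicalSpace X] [TopologicalSpace Y] (e : ContinuousMap.HomotopyEquiv X Y) (x : X) :
    FundamentalGroup X x ≃* FundamentalGroup Y (e x) :=
  (FundamentalGroupoidFunctor.equivOfHomotopyEquiv e).fullyFaithfulFunctor.mulEquivEnd
    (FundamentalGroupoid.mk x)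

namespace CohomOne

open scoped unitInterval

/-- If `γ : [0, L) → M` is a section of the orbit map with isotropy `H` at `γ 0` and `K ≤ H`
elsewhere, then `g • γ t ↦ g • γ ((1 - s) * t)` deforms `M` onto the orbit `G ⧸ H` of `γ 0`. -/
theorem exists_homotopyEquiv_quotient {G M : Type*} [Group G] [TopologicalSpace G]
    [CompactSpace G] [TopologicalSpace M] [T2Space M] [MulAction G M] [ContinuousSMul G M]
    {H K : Subgroup G} (hKH : K ≤ H) {L : EReal} (hL : 0 < L) {γ : ℝ → M}
    (hγ : ContinuousOn γ (halfOpen L))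
    (φ : MulAction.orbitRel.Quotient G M ≃ₜ halfOpen L)
    (hφ : ∀ t ∈ halfOpen L, (φ (Quotient.mk _ (γ t)) : ℝ) = t)
    (hH : MulAction.stabilizer G (γ 0) = H)
    (hK : ∀ t ∈ halfOpen L, 0 < t → MulAction.stabilizer G (γ t) = K) :
    Nonempty (ContinuousMap.HomotopyEquiv M (G ⧸ H)) := by
  have hmem0 : (0 : ℝ) ∈ halfOpen L := ⟨le_rfl, by simpa using hL⟩
  -- the parameter of the orbit of a point
  set q : M → halfOpen L := fun x => φ (Quotient.mk _ x) with hq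
  have hqc : Continuous q := φ.continuous.comp continuous_quotient_mk'
  have hqg (g : G) (x : M) : q (g • x) = q x :=
    congrArg φ (Quotient.sound ⟨g, rfl⟩)
  have hqγ (t : ℝ) (ht : t ∈ halfOpen L) : (q (γ t) : ℝ) = t := hφ t ht
  have hsurj (x : M) : ∃ g : G, g • γ (q x) = x := by
    have h1 : q (γ (q x)) = q x := Subtype.ext (hqγ _ (q x).2)
    obtain ⟨g, hg⟩ := Quotient.exact (φ.injective h1)
    exact ⟨g⁻¹, by rw [inv_smul_eq_iff]; exact hg.symm⟩
  choose a ha using hsurj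
  -- `a` is not continuous; the functions built from it are, because they can be computed with any
  -- `g` such that `(g, x)` lies in the closed relation `r` below
  have hγq : Continuous fun x : M => γ (q x) := hγ.comp_continuous (by fun_prop) fun x => (q x).2
  set r : Set (G × M) := {y | y.1 • γ (q y.2) = y.2} with hr
  have hrc : IsClosed r :=
    isClosed_eq (continuous_fst.smul (hγq.comp continuous_snd)) continuous_snd
  -- isotropy only grows along `γ` towards `γ 0`
  have hstab (t : ℝ) (ht : t ∈ halfOpen L) (g g' : G) (h : g • γ t = g' • γ t) (s : ℝ)
      (hs : s ∈ halfOpen L) (hst : s ≤ t) : g • γ s = g' • γ s := by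
    have h1 : g'⁻¹ * g ∈ MulAction.stabilizer G (γ t) := by
      rw [MulAction.mem_stabilizer_iff, mul_smul, h, inv_smul_smul]
    suffices g'⁻¹ * g ∈ MulAction.stabilizer G (γ s) by
      rwa [MulAction.mem_stabilizer_iff, mul_smul, inv_smul_eq_iff] at this
    rcases hs.1.eq_or_lt with h0 | h0
    · rcases ht.1.eq_or_lt with h2 | h2
      · rwa [← h0, h2]
      · rw [← h0, hH]; rw [hK t ht h2] at h1; exact hKH h1
    · rw [hK s hs h0]
      rwa [hK t ht (h0.trans_le hst)] at h1
  have hmk {g g' : G} (h : g • γ 0 = g' • γ 0) : (g : G ⧸ H) = g' := by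
    rw [eq_comm, QuotientGroup.eq, ← hH, MulAction.mem_stabilizer_iff, mul_smul, h,
      inv_smul_smul]
  let ret : C(M, G ⧸ H) := ⟨fun x => (a x : G ⧸ H),
    continuous_of_isClosed_rel_of_compact hrc (fun x => ⟨a x, ha x⟩)
      (continuous_quotient_mk'.comp continuous_fst) fun g x hg =>
        hmk (hstab _ (q x).2 _ _ ((ha x).trans hg.symm) 0 hmem0 (q x).2.1)⟩
  let inc : C(G ⧸ H, M) := ⟨Quotient.lift (fun g : G => g • γ 0) (by
      intro g g' hg
      have : g⁻¹ * g' ∈ H := QuotientGroup.leftRel_apply.1 hg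
      rw [← hH, MulAction.mem_stabilizer_iff, mul_smul, inv_smul_eq_iff] at this
      exact this.symm), continuous_quot_lift _ (by fun_prop)⟩
  have hscale (t : I) (x : M) : (t : ℝ) * q x ∈ halfOpen L := by
    have h1 : (t : ℝ) * q x ≤ q x := mul_le_of_le_one_left (q x).2.1 t.2.2
    exact ⟨mul_nonneg t.2.1 (q x).2.1, lt_of_le_of_lt (EReal.coe_le_coe_iff.2 h1) (q x).2.2⟩
  -- the homotopy from `inc ∘ ret` to the identity
  have hhom : Continuous fun y : I × M => a y.2 • γ (y.1 * q y.2) := by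
    have hr' : IsClosed {y : G × (I × M) | (y.1, y.2.2) ∈ r} := hrc.preimage (by fun_prop)
    have hγ' : Continuous fun y : G × (I × M) => γ (y.2.1 * q y.2.2) :=
      hγ.comp_continuous (by fun_prop) fun y => hscale _ _
    refine continuous_of_isClosed_rel_of_compact hr' (fun y => ⟨a y.2, ha y.2⟩)
      (F := fun y => y.1 • γ (y.2.1 * q y.2.2)) (continuous_fst.smul hγ') fun g y hg => ?_
    exact hstab _ (q y.2).2 _ _ ((ha y.2).trans hg.symm) _ (hscale _ _)
      (mul_le_of_le_one_left (q y.2).2.1 y.1.2.2)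
  refine ⟨⟨ret, inc, ⟨⟨⟨_, hhom⟩, fun x => ?_, fun x => ?_⟩⟩, ?_⟩⟩
  · simp [ret, inc]; rfl
  · simp [ha]
  · convert ContinuousMap.Homotopic.refl _
    ext u
    obtain ⟨g, rfl⟩ := QuotientGroup.mk_surjective u
    have h0 : (q (g • γ 0) : ℝ) = 0 := by rw [hqg, hqγ 0 hmem0]
    change (g : G ⧸ H) = a (g • γ 0)
    refine (hmk ?_).symm
    have := ha (g • γ 0)
    rwa [h0] at this

end CohomOne

/-! ### The fundamental group of the manifold -/

theorem mainTheorem4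
    {EG : Type*} [NormedAddCommGroup EG] [NormedSpace ℝ EG] [FiniteDimensional ℝ EG]
    {E : Type*} [NormedAddCommGroup E] [NormedSpace ℝ E] [FiniteDimensional ℝ E]
    -- `G` is a compact Lie group
    {G : Type*} [Group G] [TopologicalSpace G] [ChartedSpace EG G] [LieGroup 𝓘(ℝ, EG) ∞ G]
    [CompactSpace G] [T2Space G]
    -- `M` is a non-compact smooth manifold on which `G` acts smoothly
    {M : Type*} [TopologicalSpace M] [ChartedSpace E M] [IsManifold 𝓘(ℝ, E) ∞ M]
    [T2Space M] [SecondCountableTopology M] [NoncompactSpace M]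
    [MulAction G M] [ContMDiffSMul 𝓘(ℝ, EG) 𝓘(ℝ, E) ∞ G M]
    -- with cohomogeneity one and group diagram `G ⊃ H ⊃ K`, `H / K` a sphere of dimension `l ≥ 1`
    (hM : CohomOne.IsCohomogeneityOne EG E G M)
    {H K : Subgroup G} (hKH : K ≤ H) (hdiag : CohomOne.IsGroupDiagram E M EG H K)
    {l : ℕ} (hl : 1 ≤ l)
    (e : Metric.sphere (0 : EuclideanSpace ℝ (Fin (l + 1))) 1 ≃ₜ H ⧸ K.subgroupOf H) :
    (CohomOne.projHom hKH).ker = (CohomOne.inclHom H K).range ∧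
    (∀ p : M, Nonempty (FundamentalGroup M p ≃*
      FundamentalGroup (G ⧸ K) ((1 : G) : G ⧸ K) ⧸ (CohomOne.projHom hKH).ker)) ∧
    (SimplyConnectedSpace M ↔
      Subgroup.closure (Set.range (CohomOne.sphereHom e)) = ⊤) := by
  have : IsTopologicalGroup G := topologicalGroup_of_lieGroup 𝓘(ℝ, EG) ∞
  have : ContinuousSMul G M := ContMDiffSMul.continuousSMul (I := 𝓘(ℝ, EG)) (I' := 𝓘(ℝ, E)) ∞
  obtain ⟨g, L, γ, φ, -, hL, hγ, hφ, hH, hK⟩ := hdiag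
  -- `H` is an isotropy group, so `G → G ⧸ H` has local sections
  have hlift (F : ℝ × ℝ → G ⧸ H) (hF : Continuous F) :
      LiftsOn F (Set.Icc 0 1 ×ˢ Set.Icc 0 1) := by
    subst hH
    obtain ⟨σ, U, hU, hσ, hσU⟩ := exists_local_section_quotient_stabilizer EG E (G := G) (γ 0)
    exact exists_lift_square hU hσ hσU hF
  have : PathConnectedSpace (Metric.sphere (0 : EuclideanSpace ℝ (Fin (l + 1))) 1) :=
    isPathConnected_iff_pathConnectedSpace.1 (isPathConnected_sphere (by
      rw [← Module.finrank_eq_rank, finrank_euclideanSpace_fin]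
      exact_mod_cast Nat.lt_succ_of_le hl) 0 zero_le_one)
  have : PathConnectedSpace (H ⧸ K.subgroupOf H) :=
    e.surjective.pathConnectedSpace e.continuous
  have hker := CohomOne.ker_projHom hKH hlift
  obtain ⟨h⟩ := CohomOne.exists_homotopyEquiv_quotient hKH hL
    hγ.geodesic.smooth.continuousOn φ hφ hH hK
  have := hM.connected
  have : LocallyPathConnectedSpace M := ChartedSpace.locallyPathConnectedSpace E M
  have : PathConnectedSpace M := .of_locallyPathConnectedSpace
  have hjoin (p : M) : Joined (h p) ((1 : G) : G ⧸ H) :=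
    ((PathConnectedSpace.joined p (h.invFun ((1 : G) : G ⧸ H))).map h.continuous).trans
      ⟨h.right_inv.some.evalAt _⟩
  have hiso (p : M) : Nonempty (FundamentalGroup M p ≃*
      FundamentalGroup (G ⧸ K) ((1 : G) : G ⧸ K) ⧸ (CohomOne.projHom hKH).ker) :=
    ⟨((h.fundamentalGroupMulEquiv p).trans
      (FundamentalGroup.fundamentalGroupMulEquivOfPath (hjoin p).some)).trans
      (QuotientGroup.quotientKerEquivOfSurjective _ (CohomOne.projHom_surjective hKH hlift)).symm⟩
  refine ⟨hker, hiso, ?_⟩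
  have htop : (CohomOne.projHom hKH).ker = ⊤ ↔
      Subgroup.closure (Set.range (CohomOne.sphereHom e)) = ⊤ := by
    rw [← MonoidHom.coe_range, Subgroup.closure_eq, CohomOne.range_sphereHom, hker]
  rw [← htop, ← QuotientGroup.subsingleton_iff]
  constructor
  · intro _
    obtain ⟨i⟩ := hiso (γ 0)
    exact i.symm.subsingleton
  · intro _
    refine simply_connected_iff_loops_nullhomotopic.2 ⟨inferInstance, fun p c => ?_⟩
    obtain ⟨i⟩ := hiso p
    have := i.subsingleton
    exact Path.Homotopic.Quotient.exact (Subsingleton.elim (α := FundamentalGroup M p) _ _)
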